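/- Let $d\ge 2$ be an integer, $\delta\in\mathbb C\setminus\{0\}$ and $c>0$. For integers $k\ge 2$ and $1\le\nu\le k-1$ let $S:\mathbb C^k\to\mathbb C^k$ be the shift-like automorphism of type $\nu$ \[ S(z_1,\dots,z_k)=\bigl(z_2,\dots,z_k,\ \delta(z_{k-\nu+1}^d-z_1)\bigr), \] with positive Green function \[ G^+(z)=\lim_{n\to\infty}\frac1{d^n}\log^+\|S^{\nu n}(z)\| . \] For $R>0$ let $V_R=\{z\in\mathbb C^k:\|z\|_\infty<R\}$, $V_i=\{z\in\mathbb C^k:\|z\|_\infty=|z_i|\ge R\}$ for $1\le i\le k$, $V_R^+=\bigcup_{i=k-\nu+1}^{k}V_i$ and $V_R^-=\bigcup_{i=1}^{k-\nu}V_i$. (1) For all such $k$ and $\nu$, the limit $G^+(z)$ exists and is finite for every $z\in\mathbb C^k$, and there is $R_0>0$ such that for every $R\ge R_0$ one has $G^+(z)\ge c$ for all $z\in V_R^+$, and \[ \{z\in\mathbb C^k: G^+(z)<c\}\subset V_R\cup V_R^- . \] (2) Let $k\ge 3$ and $\nu=k-1$, so that $S(z_1,\dots,z_k)=(z_2,\dots,z_k,\delta(z_2^d-z_1))$.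 For every algebraic variety $\widetilde V\subset\mathbb C^k$ (the common zero set of a family of polynomials, possibly reducible) of codimension $2$, i.e. of dimension $k-2$, there is an affine change of coordinates of $\mathbb C^k$, i.e. an invertible affine map $A:\mathbb C^k\to\mathbb C^k$, such that \[ \{z\in\mathbb C^k: G^+(z)<c\}\cap A(\widetilde V)=\emptyset . \] -/

import Mathlib

open Filter Topology

/-- The shift-like map of type `ν` (with `1 ≤ ν ≤ k - 1`) on `ℂ^k`,
`S(z₁, …, z_k) = (z₂, …, z_k, δ (z_{k-ν+1}^d - z₁))`.
Coordinates are numbered from `0`, so that `z_{k-ν+1}` is the coordinate with number `k - ν`. -/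
def shiftLike {k ν : ℕ} (hν : 0 < ν) (hνk : ν < k) (d : ℕ) (δ : ℂ) (z : Fin k → ℂ) : Fin k → ℂ :=
  fun i =>
    if h : i.val + 1 < k then z ⟨i.val + 1, h⟩
    else δ * (z ⟨k - ν, by omega⟩ ^ d - z ⟨0, by omega⟩)

/-- The `n`-th term `d⁻ⁿ log⁺ ‖S^{νn}(z)‖` of the sequence that defines the positive Green
function. The norm on `Fin k → ℂ` is the maximum norm; the limit is the same for every norm. -/
noncomputable def greenPlusSeq {k ν : ℕ} (hν : 0 < ν) (hνk : ν < k) (d : ℕ) (δ : ℂ)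
    (z : Fin k → ℂ) (n : ℕ) : ℝ :=
  (1 / (d : ℝ) ^ n) * Real.posLog ‖(shiftLike hν hνk d δ)^[ν * n] z‖

/-- The positive Green function `G⁺(z) = lim_{n → ∞} d⁻ⁿ log⁺ ‖S^{νn}(z)‖`. -/
noncomputable def greenPlus {k ν : ℕ} (hν : 0 < ν) (hνk : ν < k) (d : ℕ) (δ : ℂ)
    (z : Fin k → ℂ) : ℝ :=
  limUnder atTop (greenPlusSeq hν hνk d δ z)

/-- The open polydisc `V_R = Δ^k(0; R)`. -/
def polydisc (k : ℕ) (R : ℝ) : Set (Fin k → ℂ) := {z | ∀ i, ‖z i‖ < R}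

/-- `V_i = {z : ‖z‖_∞ = |z_i| ≥ R}`. -/
def sectorV {k : ℕ} (R : ℝ) (i : Fin k) : Set (Fin k → ℂ) := {z | ‖z‖ = ‖z i‖ ∧ R ≤ ‖z i‖}

/-- `V_R⁺`, the union of the last `ν` of the sets `V_i`. -/
def filtPlus (k ν : ℕ) (R : ℝ) : Set (Fin k → ℂ) := ⋃ i : Fin k, ⋃ _ : k - ν ≤ i.val, sectorV R i

/-- `V_R⁻`, the union of the first `k - ν` of the sets `V_i`. -/
def filtMinus (k ν : ℕ) (R : ℝ) : Set (Fin k → ℂ) := ⋃ i : Fin k, ⋃ _ : i.val < k - ν, sectorV R i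

/-- `V` is an affine algebraic subset of `ℂ^k`. -/
def IsAlgebraicVariety {k : ℕ} (V : Set (Fin k → ℂ)) : Prop :=
  ∃ I : Ideal (MvPolynomial (Fin k) ℂ), V = MvPolynomial.zeroLocus ℂ I

/-- The dimension of `V`: the Krull dimension of its coordinate ring `ℂ[z₁, …, z_k] / I(V)`
(it is `⊥` for the empty set). -/
noncomputable def varietyDim {k : ℕ} (V : Set (Fin k → ℂ)) : WithBot ℕ∞ :=
  ringKrullDim (MvPolynomial (Fin k) ℂ ⧸ MvPolynomial.vanishingIdeal ℂ V)

/-!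
On `V_R⁺` with `R` large, `S^ν` keeps the point in `V_R⁺` and acts on the norm like `M ↦ |δ| M ^ d`,
up to a factor `2`. Hence consecutive terms `d⁻ⁿ log⁺ ‖S^{νn} z‖` differ by a geometrically small
amount, so that they converge and `G⁺ z ≥ log ‖z‖ - const` there. An orbit that never enters `V_R⁺`
stays bounded, and then `G⁺ z = 0`.

A variety of dimension less than `ν` lies in a hypersurface. Projecting along a direction that is
not at infinity on this hypersurface controls the norm, and repeating this with the image leads to a
linear map `π` onto `ℂ^ν` such that `‖z‖` is bounded linearly by `‖π z‖` on the variety. The image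
lies in a hypersurface of `ℂ^ν`, so it misses a ball about some point `p`. Taking a large multiple
of `π z - p` as the last `ν` coordinates moves the variety into `V_R⁺`, where `G⁺ ≥ c`.
-/

section AffineVarieties

open MvPolynomial

theorem ringKrullDim_le_of_isIntegral (R S : Type*) [CommRing R] [CommRing S] [Algebra R S]
    [Algebra.IsIntegral R S] (hinj : Function.Injective (algebraMap R S)) :
    ringKrullDim R ≤ ringKrullDim S := by
  refine iSup_le fun l => ?_
  obtain ⟨Q, -, hQ, hQl⟩ := Ideal.exists_ideal_over_prime_of_isIntegral (S := S)
    (RelSeries.head l).asIdeal ⊥ (by rw [Ideal.comap_bot_of_injective _ hinj]; exact bot_le)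
  have : Q.LiesOver (RelSeries.head l).asIdeal := ⟨hQl.symm⟩
  obtain ⟨L, hL, -, -⟩ := Ideal.exists_ltSeries_of_hasGoingUp l Q
  rw [← hL]
  exact le_iSup (fun L : LTSeries (PrimeSpectrum S) => ((L.length : ℕ∞) : WithBot ℕ∞)) L

section AlgebraicIndependence

variable {K A : Type*} [Field K] [CommRing A] [Algebra K A]

theorem exists_isPrime_algebraicIndependent_mk {ι : Type*} {x : ι → A}
    (hx : AlgebraicIndependent K x) :
    ∃ p : Ideal A, p.IsPrime ∧ AlgebraicIndependent K (Ideal.Quotient.mkₐ K p ∘ x) := by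
  obtain ⟨p, hp, hpx⟩ := Ideal.exists_comap_eq_of_mem_minimalPrimes_of_injective
    (f := (aeval x : MvPolynomial ι K →ₐ[K] A).toRingHom) hx ⊥
    (by simp only [IsDomain.minimalPrimes_eq_singleton_bot, Set.mem_singleton_iff])
  refine ⟨p, hp, algebraicIndependent_iff.mpr fun q hq => ?_⟩
  have hqp : aeval x q ∈ p := by
    rwa [← Ideal.Quotient.eq_zero_iff_mem, ← Ideal.Quotient.mkₐ_eq_mk K,
      comp_aeval_apply]
  exact hpx.le (Ideal.mem_comap.mpr hqp)

theorem natCast_le_ringKrullDim_of_algebraicIndependent_of_isDomain [IsDomain A]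
    [Algebra.FiniteType K A] {n : ℕ} {x : Fin n → A} (hx : AlgebraicIndependent K x) :
    (n : WithBot ℕ∞) ≤ ringKrullDim A := by
  obtain ⟨s, g, hg, hg_int⟩ := exists_integral_inj_algHom_of_fg K A
  algebraize [g.toRingHom]
  have hdim : (s : WithBot ℕ∞) ≤ ringKrullDim A := by
    simpa using ringKrullDim_le_of_isIntegral (MvPolynomial (Fin s) K) A hg
  have hbasis : IsTranscendenceBasis K (fun i : Fin s => g (X i)) := by
    have : IsScalarTower K (MvPolynomial (Fin s) K) A :=
      IsScalarTower.of_algebraMap_eq fun r => (g.commutes r).symm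
    have : FaithfulSMul (MvPolynomial (Fin s) K) A :=
      (faithfulSMul_iff_algebraMap_injective _ _).mpr hg
    exact (IsTranscendenceBasis.mvPolynomial (Fin s) K).algebraMap_comp
  have hns : n ≤ s := by
    simpa using hx.lift_cardinalMk_le_trdeg.trans_eq hbasis.lift_cardinalMk_eq_trdeg.symm
  exact le_trans (by exact_mod_cast hns) hdim

theorem natCast_le_ringKrullDim_of_algebraicIndependent [Algebra.FiniteType K A] {n : ℕ}
    {x : Fin n → A} (hx : AlgebraicIndependent K x) : (n : WithBot ℕ∞) ≤ ringKrullDim A := by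
  obtain ⟨p, hp, hxp⟩ := exists_isPrime_algebraicIndependent_mk hx
  exact (natCast_le_ringKrullDim_of_algebraicIndependent_of_isDomain hxp).trans
    (ringKrullDim_quotient_le p)

end AlgebraicIndependence

/-- Any `n` polynomial functions on `V` satisfy a nontrivial polynomial relation on `V`: the
elementary form of `dim V < n`, which unlike the Krull dimension visibly passes to the image of `V`
under a polynomial map. -/
def AlgDependentOn {σ K : Type*} [CommSemiring K] (n : ℕ) (V : Set (σ → K)) : Prop :=
  ∀ y : Fin n → MvPolynomial σ K, ∃ g : MvPolynomial (Fin n) K, g ≠ 0 ∧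
    ∀ z ∈ V, eval (fun i => eval z (y i)) g = 0

namespace AlgDependentOn

variable {K : Type*}

theorem of_ringKrullDim_lt {σ : Type*} [Finite σ] [Field K] {n : ℕ} {V : Set (σ → K)}
    (hV : ringKrullDim (MvPolynomial σ K ⧸ vanishingIdeal K V) < n) :
    AlgDependentOn n V := by
  intro y
  by_contra! h_indep
  refine hV.not_ge (natCast_le_ringKrullDim_of_algebraicIndependent (K := K)
    (x := Ideal.Quotient.mkₐ K (vanishingIdeal K V) ∘ y)
    (algebraicIndependent_iff.mpr fun g hg => ?_))
  by_contra hg0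
  obtain ⟨z, hz, hzg⟩ := h_indep g hg0
  have hmem : aeval y g ∈ vanishingIdeal K V := by
    rwa [← Ideal.Quotient.eq_zero_iff_mem, ← Ideal.Quotient.mkₐ_eq_mk K,
      comp_aeval_apply]
  refine hzg ?_
  rw [← mem_vanishingIdeal_iff.mp hmem z hz, comp_aeval_apply]
  simp only [aeval_eq_eval]

section CommSemiring

variable [CommSemiring K]

theorem mono {σ : Type*} {m n : ℕ} {V : Set (σ → K)} (hV : AlgDependentOn m V) (hmn : m ≤ n) :
    AlgDependentOn n V := by
  intro y
  obtain ⟨g, hg, hgV⟩ := hV (y ∘ Fin.castLE hmn)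
  refine ⟨rename (Fin.castLE hmn) g, fun h => hg ?_, fun z hz => ?_⟩
  · exact rename_injective _ (Fin.castLE_injective hmn) (by rw [h, map_zero])
  · rw [eval_rename]
    exact hgV z hz

theorem image {σ τ : Type*} {n : ℕ} {V : Set (σ → K)} (hV : AlgDependentOn n V)
    (P : τ → MvPolynomial σ K) :
    AlgDependentOn n ((fun z j => eval z (P j)) '' V) := by
  intro y
  obtain ⟨g, hg, hgV⟩ := hV fun i => bind₁ P (y i)
  refine ⟨g, hg, ?_⟩
  rintro _ ⟨z, hz, rfl⟩
  simpa only [eval, eval₂Hom_bind₁] using hgV z hz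

theorem exists_ne_zero_eval_eq_zero {n : ℕ} {V : Set (Fin n → K)} (hV : AlgDependentOn n V) :
    ∃ f : MvPolynomial (Fin n) K, f ≠ 0 ∧ ∀ z ∈ V, eval z f = 0 := by
  simpa only [eval_X] using hV X

end CommSemiring

theorem image_linearMap [CommRing K] {σ τ : Type*} [Finite σ] {n : ℕ} {V : Set (σ → K)}
    (hV : AlgDependentOn n V) (q : (σ → K) →ₗ[K] (τ → K)) : AlgDependentOn n (q '' V) := by
  classical
  cases nonempty_fintype σ
  convert hV.image (LinearMap.toMatrix' q).toMvPolynomial using 2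
  funext z
  simp only [Matrix.toMvPolynomial_eval_eq_apply, LinearMap.toMatrix'_mulVec]

end AlgDependentOn

section Homogenization

theorem eval_smul_of_isHomogeneous {σ R : Type*} [CommSemiring R] {φ : MvPolynomial σ R} {n : ℕ}
    (hφ : φ.IsHomogeneous n) (c : R) (x : σ → R) : eval (c • x) φ = c ^ n * eval x φ := by
  rw [eval_eq, eval_eq, Finset.mul_sum]
  refine Finset.sum_congr rfl fun m hm => ?_
  have hdeg : m.degree = n := by
    rw [Finsupp.degree_eq_weight_one]
    exact hφ (mem_support_iff.mp hm)
  rw [Finsupp.degree_apply] at hdeg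
  simp only [Pi.smul_apply, smul_eq_mul, mul_pow, Finset.prod_mul_distrib,
    Finset.prod_pow_eq_pow_sum, hdeg]
  ring

theorem homogeneousComponent_totalDegree_ne_zero {σ R : Type*} [CommSemiring R]
    {f : MvPolynomial σ R} (hf : f ≠ 0) : homogeneousComponent f.totalDegree f ≠ 0 := by
  obtain ⟨m, hm, hmf⟩ := Finset.exists_mem_eq_sup f.support (support_nonempty.mpr hf)
    (fun m => m.degree)
  rw [← support_nonempty, support_homogeneousComponent]
  exact ⟨m, Finset.mem_filter.mpr ⟨hm, hmf.symm⟩⟩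

/-- The homogenization of `f` at the point `x` and the value `t` of the homogenizing variable. -/
noncomputable def homogenizedEval {σ R : Type*} [CommSemiring R] (f : MvPolynomial σ R)
    (t : R) (x : σ → R) : R :=
  ∑ j ∈ Finset.range (f.totalDegree + 1),
    t ^ (f.totalDegree - j) * eval x (homogeneousComponent j f)

variable {σ R : Type*} [CommSemiring R] (f : MvPolynomial σ R)

theorem homogenizedEval_zero (x : σ → R) :
    homogenizedEval f 0 x = eval x (homogeneousComponent f.totalDegree f) := by
  rw [homogenizedEval, Finset.sum_eq_single_of_mem f.totalDegree (Finset.self_mem_range_succ _),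
    Nat.sub_self, pow_zero, one_mul]
  intro j hj hne
  have : f.totalDegree - j ≠ 0 := by
    have := Finset.mem_range.mp hj
    omega
  rw [zero_pow this, zero_mul]

theorem homogenizedEval_smul (c : R) (x : σ → R) :
    homogenizedEval f c (c • x) = c ^ f.totalDegree * eval x f := by
  have h_eval : eval x f =
      ∑ j ∈ Finset.range (f.totalDegree + 1), eval x (homogeneousComponent j f) := by
    rw [← map_sum, sum_homogeneousComponent]
  rw [homogenizedEval, h_eval, Finset.mul_sum]
  refine Finset.sum_congr rfl fun j hj => ?_
  rw [eval_smul_of_isHomogeneous (homogeneousComponent_isHomogeneous j f), ← mul_assoc, ← pow_add,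
    Nat.sub_add_cancel (Finset.mem_range_succ_iff.mp hj)]

theorem continuous_homogenizedEval [TopologicalSpace R] [IsTopologicalSemiring R] :
    Continuous fun q : R × (σ → R) => homogenizedEval f q.1 q.2 :=
  continuous_finsetSum _ fun _ _ =>
    (continuous_fst.pow _).mul ((continuous_eval _).comp continuous_snd)

end Homogenization

theorem exists_eval_ne_zero {σ R : Type*} [CommRing R] [IsDomain R] [Infinite R]
    {f : MvPolynomial σ R} (hf : f ≠ 0) : ∃ x, eval x f ≠ 0 := by
  by_contra! h
  exact hf (MvPolynomial.funext (by simpa only [map_zero] using h))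

/-- The norm on `V` grows at most linearly in the norm of the image under `q`. For a linear map `q`
and an algebraic set `V ⊆ ℂ^k` this is finiteness of `q` on `V`. -/
def ControlsNormOn {E F : Type*} [Norm E] [Norm F] (q : E → F) (V : Set E) : Prop :=
  ∃ C : ℝ, 0 ≤ C ∧ ∀ z ∈ V, ‖z‖ ≤ C * max 1 ‖q z‖

theorem ControlsNormOn.comp {E F G : Type*} [Norm E] [Norm F] [Norm G] {q : E → F} {π : F → G}
    {V : Set E} (hπ : ControlsNormOn π (q '' V)) (hq : ControlsNormOn q V) :
    ControlsNormOn (π ∘ q) V := by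
  obtain ⟨C, hC, hCV⟩ := hq
  obtain ⟨C', -, hCV'⟩ := hπ
  refine ⟨C * max 1 C', by positivity, fun z hz => (hCV z hz).trans ?_⟩
  have h_max : max 1 ‖q z‖ ≤ max 1 C' * max 1 ‖π (q z)‖ := by
    refine max_le (one_le_mul_of_one_le_of_one_le (le_max_left _ _) (le_max_left _ _)) ?_
    refine (hCV' _ (Set.mem_image_of_mem q hz)).trans ?_
    gcongr
    exact le_max_right _ _
  rw [mul_assoc]
  gcongr
  exact h_max

theorem exists_surjective_ker_eq_span_singleton {K : Type*} [Field K] {k : ℕ} {v : Fin (k + 1) → K}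
    (hv : v ≠ 0) :
    ∃ q : (Fin (k + 1) → K) →ₗ[K] (Fin k → K),
      Function.Surjective q ∧ LinearMap.ker q = Submodule.span K {v} := by
  have h_rank : Module.finrank K ((Fin (k + 1) → K) ⧸ Submodule.span K {v}) =
      Module.finrank K (Fin k → K) := by
    have := (Submodule.span K {v}).finrank_quotient_add_finrank
    rw [finrank_span_singleton hv, Module.finrank_fin_fun] at this
    rw [Module.finrank_fin_fun]
    omega
  let e := LinearEquiv.ofFinrankEq _ _ h_rank
  refine ⟨e.toLinearMap ∘ₗ (Submodule.span K {v}).mkQ,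
    e.surjective.comp (Submodule.mkQ_surjective _), ?_⟩
  rw [LinearEquiv.ker_comp, Submodule.ker_mkQ]

section NontriviallyNormedField

variable {𝕜 : Type*} [NontriviallyNormedField 𝕜]

theorem exists_le_norm_sub_of_eval_eq_zero {σ : Type*} [Fintype σ] {f : MvPolynomial σ 𝕜}
    (hf : f ≠ 0) :
    ∃ (p : σ → 𝕜) (r : ℝ), 0 < r ∧ ∀ x, eval x f = 0 → r ≤ ‖x - p‖ := by
  obtain ⟨p, hp⟩ := exists_eval_ne_zero hf
  obtain ⟨r, hr, hball⟩ := Metric.eventually_nhds_iff.mp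
    ((continuous_eval f).continuousAt.eventually_ne hp)
  refine ⟨p, r, hr, fun x hx => ?_⟩
  by_contra! hlt
  exact hball (by rwa [dist_eq_norm]) hx

-- A direction on which the top homogeneous part of `f` does not vanish is a point at infinity off
-- the hypersurface `f = 0`; by continuity of the homogenization so is every nearby point.
theorem exists_ne_zero_norm_le_of_eval_eq_zero {σ : Type*} [Fintype σ] [Nonempty σ]
    {f : MvPolynomial σ 𝕜} (hf : f ≠ 0) :
    ∃ v : σ → 𝕜, v ≠ 0 ∧ ∃ r : ℝ, 0 < r ∧
      ∀ z, eval z f = 0 → ∀ w : 𝕜, r * ‖w‖ ≤ max 1 ‖z - w • v‖ := by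
  obtain ⟨i⟩ := ‹Nonempty σ›
  obtain ⟨v, hv⟩ := exists_eval_ne_zero
    (mul_ne_zero (homogeneousComponent_totalDegree_ne_zero hf) (X_ne_zero i))
  rw [map_mul, eval_X, ← homogenizedEval_zero] at hv
  obtain ⟨r, hr, hball⟩ := Metric.eventually_nhds_iff.mp
    ((continuous_homogenizedEval f).continuousAt.eventually_ne
      (x := (0, v)) (left_ne_zero_of_mul hv))
  refine ⟨v, fun h => right_ne_zero_of_mul hv (congrFun h i), r, hr, fun z hz w => ?_⟩
  by_contra! hlt
  obtain ⟨h1, hzw⟩ := max_lt_iff.mp hlt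
  have hw : w ≠ 0 := fun h => by
    rw [h, norm_zero, mul_zero] at h1
    linarith
  have hw_pos : 0 < ‖w‖ := norm_pos_iff.mpr hw
  have h_dist : ‖w⁻¹ • z - v‖ < r := by
    rwa [← inv_smul_smul₀ hw v, ← smul_sub, norm_smul, norm_inv, inv_mul_lt_iff₀ hw_pos, mul_comm]
  refine hball (y := (w⁻¹, w⁻¹ • z)) ?_ (by rw [homogenizedEval_smul, hz, mul_zero])
  rw [Prod.dist_eq, max_lt_iff, dist_zero_right, norm_inv, dist_eq_norm]
  exact ⟨(inv_lt_iff_one_lt_mul₀ hw_pos).mpr h1, h_dist⟩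

section CompleteSpace

variable [CompleteSpace 𝕜]

theorem exists_surjective_controlsNormOn_of_ne_zero {k : ℕ} {f : MvPolynomial (Fin (k + 1)) 𝕜}
    (hf : f ≠ 0) :
    ∃ q : (Fin (k + 1) → 𝕜) →ₗ[𝕜] (Fin k → 𝕜),
      Function.Surjective q ∧ ControlsNormOn q {z | eval z f = 0} := by
  obtain ⟨v, hv, r, hr, hrf⟩ := exists_ne_zero_norm_le_of_eval_eq_zero hf
  obtain ⟨q, hq, hq_ker⟩ := exists_surjective_ker_eq_span_singleton hv
  obtain ⟨s, hs⟩ := q.exists_rightInverse_of_surjective (LinearMap.range_eq_top.mpr hq)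
  set S := s.toContinuousLinearMap
  refine ⟨q, hq, (1 + ‖S‖) / r * ‖v‖ + ‖S‖, by positivity, fun z hz => ?_⟩
  obtain ⟨w, hw⟩ : ∃ w : 𝕜, w • v = z - S (q z) := by
    rw [← Submodule.mem_span_singleton, ← hq_ker, LinearMap.mem_ker, map_sub, sub_eq_zero]
    exact (LinearMap.congr_fun hs (q z)).symm
  set M := max 1 ‖q z‖
  have hS : ‖S (q z)‖ ≤ ‖S‖ * M := (S.le_opNorm _).trans (by gcongr; exact le_max_right _ _)
  have h_w : ‖w‖ ≤ (1 + ‖S‖) / r * M := by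
    rw [div_mul_eq_mul_div, le_div_iff₀' hr]
    have hM : 1 ≤ M := le_max_left _ _
    refine (hrf z hz w).trans (max_le ?_ ?_)
    · nlinarith [norm_nonneg S]
    · rw [hw, sub_sub_cancel]
      linarith
  calc ‖z‖ = ‖w • v + S (q z)‖ := by rw [hw, sub_add_cancel]
    _ ≤ ‖w‖ * ‖v‖ + ‖S (q z)‖ := (norm_add_le _ _).trans_eq (by rw [norm_smul])
    _ ≤ (1 + ‖S‖) / r * M * ‖v‖ + ‖S‖ * M := by gcongr
    _ = ((1 + ‖S‖) / r * ‖v‖ + ‖S‖) * M := by ring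

-- A metric form of Noether normalization.
theorem exists_surjective_controlsNormOn {n k : ℕ} (hnk : n ≤ k) {V : Set (Fin k → 𝕜)}
    (hV : AlgDependentOn n V) :
    ∃ π : (Fin k → 𝕜) →ₗ[𝕜] (Fin n → 𝕜), Function.Surjective π ∧ ControlsNormOn π V := by
  induction k, hnk using Nat.le_induction with
  | base =>
    refine ⟨LinearMap.id, Function.surjective_id, 1, zero_le_one, fun z _ => ?_⟩
    rw [one_mul]
    exact le_max_right _ _
  | succ k hnk ih =>
    obtain ⟨f, hf, hfV⟩ := (hV.mono (by omega : n ≤ k + 1)).exists_ne_zero_eval_eq_zero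
    obtain ⟨q, hq, C, hC, hqC⟩ := exists_surjective_controlsNormOn_of_ne_zero hf
    obtain ⟨π, hπ, hπV⟩ := ih (hV.image_linearMap q)
    exact ⟨π ∘ₗ q, hπ.comp hq, hπV.comp ⟨C, hC, fun z hz => hqC z (hfV z hz)⟩⟩

theorem exists_surjective_norm_le_norm_sub {n k : ℕ} (hnk : n ≤ k) {V : Set (Fin k → 𝕜)}
    (hV : AlgDependentOn n V) :
    ∃ (π : (Fin k → 𝕜) →ₗ[𝕜] (Fin n → 𝕜)) (p : Fin n → 𝕜) (r C : ℝ), Function.Surjective π ∧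
      0 < r ∧ 0 ≤ C ∧ ∀ z ∈ V, r ≤ ‖π z - p‖ ∧ ‖z‖ ≤ C * ‖π z - p‖ := by
  obtain ⟨π, hπ, C, hC, hCV⟩ := exists_surjective_controlsNormOn hnk hV
  obtain ⟨g, hg, hgV⟩ := (hV.image_linearMap π).exists_ne_zero_eval_eq_zero
  obtain ⟨p, r, hr, hrg⟩ := exists_le_norm_sub_of_eval_eq_zero hg
  refine ⟨π, p, r, C * ((1 + ‖p‖) / r + 1), hπ, hr, by positivity, fun z hz => ?_⟩
  have h_far : r ≤ ‖π z - p‖ := hrg _ (hgV _ (Set.mem_image_of_mem π hz))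
  refine ⟨h_far, (hCV z hz).trans ?_⟩
  have h_const : 1 + ‖p‖ ≤ (1 + ‖p‖) / r * ‖π z - p‖ := by
    rw [div_mul_eq_mul_div, le_div_iff₀ hr]
    gcongr
  have h_max : max 1 ‖π z‖ ≤ 1 + ‖p‖ + ‖π z - p‖ := by
    have : ‖π z‖ ≤ ‖π z - p‖ + ‖p‖ := norm_le_norm_sub_add _ _
    exact max_le (by linarith [norm_nonneg p, norm_nonneg (π z - p)]) (by linarith)
  rw [mul_assoc]
  gcongr
  linarith

end CompleteSpace

end NontriviallyNormedField

theorem exists_injective_prod_of_surjective {K : Type*} [Field K] {m n : ℕ}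
    {π : (Fin (m + n) → K) →ₗ[K] (Fin n → K)} (hπ : Function.Surjective π) :
    ∃ ρ : (Fin (m + n) → K) →ₗ[K] (Fin m → K), Function.Injective (ρ.prod π) := by
  have h_rank : Module.finrank K (LinearMap.ker π) = Module.finrank K (Fin m → K) := by
    have := π.finrank_range_add_finrank_ker
    rw [LinearMap.range_eq_top.mpr hπ, finrank_top] at this
    simp only [Module.finrank_fin_fun] at this ⊢
    omega
  obtain ⟨g, hg⟩ := (LinearMap.ker π).subtype.exists_leftInverse_of_injective
    (Submodule.ker_subtype _)
  let e := LinearEquiv.ofFinrankEq _ _ h_rank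
  refine ⟨e.toLinearMap ∘ₗ g, (injective_iff_map_eq_zero _).mpr fun z hz => ?_⟩
  obtain ⟨hgz, hπz⟩ := Prod.mk.inj hz
  calc z = (g z : Fin (m + n) → K) := congrArg Subtype.val (LinearMap.congr_fun hg ⟨z, hπz⟩).symm
    _ = 0 := by rw [e.map_eq_zero_iff.mp hgz, Submodule.coe_zero]

theorem exists_affineEquiv_eq_append {K : Type*} [Field K] {m n : ℕ}
    {ρ : (Fin (m + n) → K) →ₗ[K] (Fin m → K)} {π : (Fin (m + n) → K) →ₗ[K] (Fin n → K)}
    (hρπ : Function.Injective (ρ.prod π)) {a : K} (ha : a ≠ 0) (p : Fin n → K) :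
    ∃ A : (Fin (m + n) → K) ≃ᵃ[K] (Fin (m + n) → K),
      ∀ z, A z = Fin.append (ρ z) (a • (π z - p)) := by
  let L : (Fin (m + n) → K) →ₗ[K] (Fin (m + n) → K) := LinearMap.pi
    (Fin.addCases (fun i => LinearMap.proj i ∘ₗ ρ) fun j => a • (LinearMap.proj j ∘ₗ π))
  have hL_apply (z : Fin (m + n) → K) : L z = Fin.append (ρ z) (a • π z) := by
    refine funext <| Fin.addCases (fun i => ?_) fun j => ?_
    all_goals simp [L]
  have hL : Function.Injective L := by
    refine (injective_iff_map_eq_zero L).mpr fun z hz => ?_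
    rw [hL_apply] at hz
    have hρz : ρ z = 0 := funext fun i => by simpa using congrFun hz (Fin.castAdd n i)
    have hπz : π z = 0 := funext fun j => by simpa [ha] using congrFun hz (Fin.natAdd m j)
    exact (injective_iff_map_eq_zero _).mp hρπ z (Prod.ext hρz hπz)
  refine ⟨(LinearEquiv.ofInjectiveEndo L hL).toAffineEquiv.trans
    (AffineEquiv.constVAdd K _ (Fin.append 0 (-(a • p)))), fun z => ?_⟩
  refine funext <| Fin.addCases (fun i => ?_) fun j => ?_
  · simp [hL_apply]
  · simp [hL_apply, sub_eq_neg_add]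

end AffineVarieties

theorem exists_tendsto_div_pow_of_abs_sub_mul_le {a : ℕ → ℝ} {q C : ℝ} (hq : 1 < q)
    (ha : ∀ n, |a (n + 1) - q * a n| ≤ C) :
    ∃ G, Tendsto (fun n => a n / q ^ n) atTop (𝓝 G) ∧ |a 0 - G| ≤ C / (q - 1) := by
  have hq0 : 0 < q := zero_lt_one.trans hq
  have h_step (n : ℕ) :
      dist (a n / q ^ n) (a (n + 1) / q ^ (n + 1)) ≤ C / q * (1 / q) ^ n := by
    have h_diff : a (n + 1) / q ^ (n + 1) - a n / q ^ n = (a (n + 1) - q * a n) / q ^ (n + 1) := by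
      field_simp
      ring
    rw [dist_comm, Real.dist_eq, h_diff, abs_div, abs_of_pos (pow_pos hq0 _)]
    calc |a (n + 1) - q * a n| / q ^ (n + 1) ≤ C / q ^ (n + 1) := by gcongr; exact ha n
      _ = C / q * (1 / q) ^ n := by rw [one_div_pow, pow_succ']; field_simp
  have h_ratio : 1 / q < 1 := (div_lt_one hq0).mpr hq
  obtain ⟨G, hG⟩ := cauchySeq_tendsto_of_complete (cauchySeq_of_le_geometric _ _ h_ratio h_step)
  refine ⟨G, hG, ?_⟩
  have h_sum : C / q / (1 - 1 / q) = C / (q - 1) := by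
    have : q - 1 ≠ 0 := (sub_pos.mpr hq).ne'
    field_simp
  simpa only [Real.dist_eq, pow_zero, div_one, h_sum] using
    dist_le_of_le_geometric_of_tendsto₀ _ _ h_ratio h_step hG

section Filtration

variable {k ν : ℕ} {R : ℝ} {z : Fin k → ℂ}

theorem mem_filtPlus_iff :
    z ∈ filtPlus k ν R ↔ ∃ i : Fin k, k - ν ≤ i.val ∧ ‖z‖ = ‖z i‖ ∧ R ≤ ‖z i‖ := by
  simp only [filtPlus, sectorV, Set.mem_iUnion, Set.mem_ofPred_eq, exists_prop]

theorem mem_filtMinus_iff :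
    z ∈ filtMinus k ν R ↔ ∃ i : Fin k, i.val < k - ν ∧ ‖z‖ = ‖z i‖ ∧ R ≤ ‖z i‖ := by
  simp only [filtMinus, sectorV, Set.mem_iUnion, Set.mem_ofPred_eq, exists_prop]

theorem le_norm_of_mem_filtPlus (hz : z ∈ filtPlus k ν R) : R ≤ ‖z‖ := by
  obtain ⟨i, -, hzi, hRi⟩ := mem_filtPlus_iff.mp hz
  rwa [hzi]

theorem mem_filtPlus_of_forall_lt_norm_le {i : Fin k} (hi : k - ν ≤ i.val) (hRi : R ≤ ‖z i‖)
    (hz : ∀ j : Fin k, j.val < k - ν → ‖z j‖ ≤ ‖z i‖) : z ∈ filtPlus k ν R := by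
  have : Nonempty (Fin k) := ⟨i⟩
  obtain ⟨j, hj : ‖z j‖ = ‖z‖⟩ := (IsGreatest.pi_norm z).1
  rw [mem_filtPlus_iff]
  rcases lt_or_ge j.val (k - ν) with hjk | hjk
  · exact ⟨i, hi, (hj.symm.trans_le (hz j hjk)).antisymm (norm_le_pi_norm z i), hRi⟩
  · exact ⟨j, hjk, hj.symm, hRi.trans (hj ▸ norm_le_pi_norm z i)⟩

theorem mem_polydisc_union_filtMinus_of_notMem_filtPlus [NeZero k] (hz : z ∉ filtPlus k ν R) :
    z ∈ polydisc k R ∪ filtMinus k ν R := by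
  obtain ⟨j, hj : ‖z j‖ = ‖z‖⟩ := (IsGreatest.pi_norm z).1
  rcases lt_or_ge ‖z j‖ R with hlt | hge
  · exact Or.inl fun i => (norm_le_pi_norm z i).trans_lt (hj ▸ hlt)
  · refine Or.inr (mem_filtMinus_iff.mpr ⟨j, ?_, hj.symm, hge⟩)
    by_contra! h
    exact hz (mem_filtPlus_iff.mpr ⟨j, h, hj.symm, hge⟩)

theorem append_mem_filtPlus {m n : ℕ} [NeZero n] {x : Fin m → ℂ} {y : Fin n → ℂ} (hxy : ‖x‖ ≤ ‖y‖)
    (hy : R ≤ ‖y‖) : Fin.append x y ∈ filtPlus (m + n) n R := by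
  obtain ⟨j, hj : ‖y j‖ = ‖y‖⟩ := (IsGreatest.pi_norm y).1
  refine mem_filtPlus_of_forall_lt_norm_le (i := Fin.natAdd m j) (by simp) ?_ fun i hi => ?_
  · rwa [Fin.append_right, hj]
  · obtain ⟨i, rfl⟩ : ∃ i', i = Fin.castAdd n i' := ⟨⟨i, by omega⟩, rfl⟩
    rw [Fin.append_left, Fin.append_right, hj]
    exact (norm_le_pi_norm x i).trans hxy

end Filtration

theorem exists_affineEquiv_image_subset_filtPlus {k ν : ℕ} (hν : 0 < ν) (hνk : ν ≤ k)
    {V : Set (Fin k → ℂ)} (hV : varietyDim V < ν) (R : ℝ) :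
    ∃ A : (Fin k → ℂ) ≃ᵃ[ℂ] (Fin k → ℂ), A '' V ⊆ filtPlus k ν R := by
  have : NeZero ν := ⟨hν.ne'⟩
  obtain ⟨π, p, r, C, hπ, hr, hC, hVπ⟩ :=
    exists_surjective_norm_le_norm_sub hνk (AlgDependentOn.of_ringKrullDim_lt hV)
  obtain ⟨m, rfl⟩ := Nat.exists_eq_add_of_le' hνk
  obtain ⟨ρ, hρ⟩ := exists_injective_prod_of_surjective hπ
  set B := ‖ρ.toContinuousLinearMap‖ * C
  obtain ⟨a, ha⟩ := NormedField.exists_lt_norm ℂ (max B (R / r))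
  obtain ⟨haB, haR⟩ := max_lt_iff.mp ha
  have ha0 : a ≠ 0 := norm_pos_iff.mp ((by positivity : 0 ≤ B).trans_lt haB)
  obtain ⟨A, hA⟩ := exists_affineEquiv_eq_append hρ ha0 p
  refine ⟨A, Set.image_subset_iff.mpr fun z hz => ?_⟩
  obtain ⟨h_far, h_norm⟩ := hVπ z hz
  rw [Set.mem_preimage, hA]
  refine append_mem_filtPlus ?_ ?_
  · calc ‖ρ z‖ ≤ ‖ρ.toContinuousLinearMap‖ * ‖z‖ := ρ.toContinuousLinearMap.le_opNorm z
      _ ≤ ‖ρ.toContinuousLinearMap‖ * (C * ‖π z - p‖) := by gcongr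
      _ = B * ‖π z - p‖ := (mul_assoc _ _ _).symm
      _ ≤ ‖a • (π z - p)‖ := by rw [norm_smul]; gcongr
  · calc R ≤ ‖a‖ * r := ((div_lt_iff₀ hr).mp haR).le
      _ ≤ ‖a • (π z - p)‖ := by rw [norm_smul]; gcongr

section Dynamics

variable {k ν : ℕ} (hν : 0 < ν) (hνk : ν < k) (d : ℕ) (δ : ℂ)

/-- The iterate `S^ν` of the shift-like map. Unlike `S` itself, it maps `V_R⁺` into itself for
large `R`. -/
def shiftLikeStep : (Fin k → ℂ) → Fin k → ℂ := (shiftLike hν hνk d δ)^[ν]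

theorem shiftLike_iterate_apply (z : Fin k → ℂ) {m : ℕ} (hm : m ≤ ν) (i : Fin k) :
    (shiftLike hν hνk d δ)^[m] z i =
      if h : i.val + m < k then z ⟨i.val + m, h⟩
      else δ * (z ⟨i.val + m - ν, by omega⟩ ^ d - z ⟨i.val + m - k, by omega⟩) := by
  induction m generalizing i with
  | zero => simp
  | succ m ih =>
    rw [Function.iterate_succ_apply', shiftLike]
    split_ifs with h1 h2 h2
    · rw [ih (by omega), dif_pos (by simp only; omega)]
      congr 2; grind
    · rw [ih (by omega), dif_neg (by simp only; omega)]
      congr! 5 <;> grind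
    · omega
    · rw [ih (by omega), ih (by omega), dif_pos (by simp only; omega),
        dif_pos (by simp only; omega)]
      congr! 4 <;> grind

theorem shiftLikeStep_apply_of_lt (z : Fin k → ℂ) (i : Fin k) (hi : i.val < k - ν) :
    shiftLikeStep hν hνk d δ z i = z ⟨i.val + ν, by omega⟩ := by
  rw [shiftLikeStep, shiftLike_iterate_apply hν hνk d δ z le_rfl, dif_pos]

theorem shiftLikeStep_apply_of_le (z : Fin k → ℂ) (i : Fin k) (hi : k - ν ≤ i.val) :
    shiftLikeStep hν hνk d δ z i = δ * (z i ^ d - z ⟨i.val + ν - k, by omega⟩) := by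
  rw [shiftLikeStep, shiftLike_iterate_apply hν hνk d δ z le_rfl, dif_neg (by omega)]
  congr! 4
  exact Fin.ext (Nat.add_sub_cancel _ _)

theorem norm_shiftLikeStep_apply_le_norm (z : Fin k → ℂ) {i : Fin k} (hi : i.val < k - ν) :
    ‖shiftLikeStep hν hνk d δ z i‖ ≤ ‖z‖ := by
  rw [shiftLikeStep_apply_of_lt hν hνk d δ z i hi]
  exact norm_le_pi_norm _ _

theorem norm_shiftLikeStep_apply_le (z : Fin k → ℂ) {i : Fin k} (hi : k - ν ≤ i.val) :
    ‖shiftLikeStep hν hνk d δ z i‖ ≤ ‖δ‖ * (‖z‖ ^ d + ‖z‖) := by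
  rw [shiftLikeStep_apply_of_le hν hνk d δ z i hi, norm_mul]
  gcongr
  refine (norm_sub_le _ _).trans (add_le_add ?_ (norm_le_pi_norm _ _))
  rw [norm_pow]
  gcongr
  exact norm_le_pi_norm _ _

theorem le_norm_shiftLikeStep_apply {z : Fin k → ℂ} {i : Fin k} (hi : k - ν ≤ i.val)
    (hzi : ‖z‖ = ‖z i‖) : ‖δ‖ * (‖z‖ ^ d - ‖z‖) ≤ ‖shiftLikeStep hν hνk d δ z i‖ := by
  rw [shiftLikeStep_apply_of_le hν hνk d δ z i hi, norm_mul]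
  gcongr
  refine le_trans ?_ (norm_sub_norm_le _ _)
  rw [norm_pow, ← hzi]
  exact sub_le_sub_left (norm_le_pi_norm _ _) _

theorem norm_shiftLikeStep_le_of_notMem_filtPlus {R : ℝ} {z : Fin k → ℂ}
    (hz : shiftLikeStep hν hνk d δ z ∉ filtPlus k ν R) :
    ‖shiftLikeStep hν hνk d δ z‖ ≤ max ‖z‖ R := by
  have : NeZero k := ⟨by omega⟩
  obtain ⟨j, hj⟩ : ∃ j, ‖shiftLikeStep hν hνk d δ z j‖ = ‖shiftLikeStep hν hνk d δ z‖ :=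
    (IsGreatest.pi_norm _).1
  rcases lt_or_ge j.val (k - ν) with hjk | hjk
  · rw [← hj]
    exact (norm_shiftLikeStep_apply_le_norm hν hνk d δ z hjk).trans (le_max_left _ _)
  · by_contra! hlt
    exact hz (mem_filtPlus_iff.mpr ⟨j, hjk, hj.symm, hj ▸ (le_max_right _ _).trans hlt.le⟩)

/-- A radius beyond which `|δ| M ^ d` exceeds `2 M`, so that on `V_R⁺` the term `z_i ^ d` dominates
in `S^ν`. -/
noncomputable def escapeRadius (δ : ℂ) : ℝ := max 2 (2 / ‖δ‖)

/-- A bound for `|log⁺ ‖S^ν z‖ - d log⁺ ‖z‖|` on `V_R⁺`. -/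
noncomputable def greenError (δ : ℂ) : ℝ := Real.log 2 + |Real.log ‖δ‖|

variable {d δ} {R : ℝ}

theorem two_mul_le_pow_of_escapeRadius_le (hd : 2 ≤ d) {M : ℝ} (hM : escapeRadius δ ≤ M) :
    2 * M ≤ M ^ d := by
  have hM2 : 2 ≤ M := (le_max_left _ _).trans hM
  calc 2 * M ≤ M ^ 2 := by nlinarith
    _ ≤ M ^ d := pow_le_pow_right₀ (by linarith) hd

theorem le_norm_mul_pow_sub_of_escapeRadius_le (hd : 2 ≤ d) (hδ : δ ≠ 0) {M : ℝ}
    (hM : escapeRadius δ ≤ M) : M ≤ ‖δ‖ * (M ^ d - M) := by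
  have hM2 : 2 ≤ M := (le_max_left _ _).trans hM
  have hMδ : 2 ≤ M * ‖δ‖ := (div_le_iff₀ (norm_pos_iff.mpr hδ)).mp ((le_max_right _ _).trans hM)
  have h_sq : M * (M - 1) ≤ M ^ d - M := by
    linarith [pow_le_pow_right₀ (by linarith : 1 ≤ M) hd]
  calc M ≤ 2 * (M - 1) := by linarith
    _ ≤ M * ‖δ‖ * (M - 1) := by gcongr; linarith
    _ = ‖δ‖ * (M * (M - 1)) := by ring
    _ ≤ ‖δ‖ * (M ^ d - M) := by gcongr

theorem shiftLikeStep_mem_filtPlus (hd : 2 ≤ d) (hδ : δ ≠ 0) (hR : escapeRadius δ ≤ R)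
    {z : Fin k → ℂ} (hz : z ∈ filtPlus k ν R) : shiftLikeStep hν hνk d δ z ∈ filtPlus k ν R := by
  obtain ⟨i, hi, hzi, hRi⟩ := mem_filtPlus_iff.mp hz
  have h_grow : ‖z‖ ≤ ‖shiftLikeStep hν hνk d δ z i‖ :=
    (le_norm_mul_pow_sub_of_escapeRadius_le hd hδ (hR.trans (hzi ▸ hRi))).trans
      (le_norm_shiftLikeStep_apply hν hνk d δ hi hzi)
  exact mem_filtPlus_of_forall_lt_norm_le hi ((hzi ▸ hRi).trans h_grow) fun j hj =>
    (norm_shiftLikeStep_apply_le_norm hν hνk d δ z hj).trans h_grow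

theorem norm_mul_pow_div_two_le_norm_shiftLikeStep (hd : 2 ≤ d) (hR : escapeRadius δ ≤ R)
    {z : Fin k → ℂ} (hz : z ∈ filtPlus k ν R) :
    ‖δ‖ * ‖z‖ ^ d / 2 ≤ ‖shiftLikeStep hν hνk d δ z‖ := by
  obtain ⟨i, hi, hzi, -⟩ := mem_filtPlus_iff.mp hz
  have h_pow : 2 * ‖z‖ ≤ ‖z‖ ^ d :=
    two_mul_le_pow_of_escapeRadius_le hd (hR.trans (le_norm_of_mem_filtPlus hz))
  calc ‖δ‖ * ‖z‖ ^ d / 2 = ‖δ‖ * (‖z‖ ^ d / 2) := by ring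
    _ ≤ ‖δ‖ * (‖z‖ ^ d - ‖z‖) := by gcongr; linarith
    _ ≤ ‖shiftLikeStep hν hνk d δ z i‖ := le_norm_shiftLikeStep_apply hν hνk d δ hi hzi
    _ ≤ ‖shiftLikeStep hν hνk d δ z‖ := norm_le_pi_norm _ _

theorem norm_shiftLikeStep_le_two_mul (hd : 2 ≤ d) (hδ : δ ≠ 0) {z : Fin k → ℂ}
    (hz : escapeRadius δ ≤ ‖z‖) :
    ‖shiftLikeStep hν hνk d δ z‖ ≤ 2 * (‖δ‖ * ‖z‖ ^ d) := by
  have h_pow := two_mul_le_pow_of_escapeRadius_le hd hz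
  have h_grow := le_norm_mul_pow_sub_of_escapeRadius_le hd hδ hz
  refine (pi_norm_le_iff_of_nonneg (by positivity)).mpr fun i => ?_
  rcases lt_or_ge i.val (k - ν) with hi | hi
  · have := norm_shiftLikeStep_apply_le_norm hν hνk d δ z hi
    nlinarith [norm_nonneg z, norm_nonneg δ]
  · calc ‖shiftLikeStep hν hνk d δ z i‖ ≤ ‖δ‖ * (‖z‖ ^ d + ‖z‖) :=
          norm_shiftLikeStep_apply_le hν hνk d δ z hi
      _ ≤ ‖δ‖ * (2 * ‖z‖ ^ d) := by gcongr; linarith [norm_nonneg z]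
      _ = 2 * (‖δ‖ * ‖z‖ ^ d) := by ring

theorem posLog_norm_eq_log_norm (hR : escapeRadius δ ≤ R) {z : Fin k → ℂ}
    (hz : z ∈ filtPlus k ν R) : Real.posLog ‖z‖ = Real.log ‖z‖ := by
  have h2 : 2 ≤ ‖z‖ := (le_max_left _ _).trans (hR.trans (le_norm_of_mem_filtPlus hz))
  exact Real.posLog_eq_log (by rw [abs_norm]; linarith)

theorem abs_posLog_shiftLikeStep_sub_le (hd : 2 ≤ d) (hδ : δ ≠ 0) (hR : escapeRadius δ ≤ R)
    {z : Fin k → ℂ} (hz : z ∈ filtPlus k ν R) :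
    |Real.posLog ‖shiftLikeStep hν hνk d δ z‖ - d * Real.posLog ‖z‖| ≤ greenError δ := by
  have hzR := hR.trans (le_norm_of_mem_filtPlus hz)
  have hδ_pos : 0 < ‖δ‖ := norm_pos_iff.mpr hδ
  have hz_pos : 0 < ‖z‖ := zero_lt_two.trans_le ((le_max_left _ _).trans hzR)
  have h_lower := norm_mul_pow_div_two_le_norm_shiftLikeStep hν hνk hd hR hz
  have h_upper := norm_shiftLikeStep_le_two_mul hν hνk hd hδ hzR
  have h_log : Real.log (‖δ‖ * ‖z‖ ^ d) = Real.log ‖δ‖ + d * Real.log ‖z‖ := by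
    rw [Real.log_mul hδ_pos.ne' (by positivity), Real.log_pow]
  have h_log_lower := Real.log_le_log (by positivity) h_lower
  have h_log_upper := Real.log_le_log (lt_of_lt_of_le (by positivity) h_lower) h_upper
  rw [Real.log_div (by positivity) two_ne_zero, h_log] at h_log_lower
  rw [Real.log_mul two_ne_zero (by positivity), h_log] at h_log_upper
  rw [posLog_norm_eq_log_norm hR (shiftLikeStep_mem_filtPlus hν hνk hd hδ hR hz),
    posLog_norm_eq_log_norm hR hz, abs_le, greenError]
  constructor <;> linarith [neg_abs_le (Real.log ‖δ‖), le_abs_self (Real.log ‖δ‖)]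

theorem greenPlusSeq_eq_posLog_div_pow (z : Fin k → ℂ) (n : ℕ) :
    greenPlusSeq hν hνk d δ z n = Real.posLog ‖(shiftLikeStep hν hνk d δ)^[n] z‖ / (d : ℝ) ^ n := by
  rw [greenPlusSeq, Function.iterate_mul, one_div_mul_eq_div, shiftLikeStep]

theorem greenPlusSeq_add (z : Fin k → ℂ) (n m : ℕ) :
    greenPlusSeq hν hνk d δ z (n + m) =
      greenPlusSeq hν hνk d δ ((shiftLikeStep hν hνk d δ)^[m] z) n / (d : ℝ) ^ m := by
  simp only [greenPlusSeq_eq_posLog_div_pow, Function.iterate_add_apply, pow_add, div_div]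

theorem exists_tendsto_greenPlusSeq_of_mem_filtPlus (hd : 2 ≤ d) (hδ : δ ≠ 0)
    (hR : escapeRadius δ ≤ R) {z : Fin k → ℂ} (hz : z ∈ filtPlus k ν R) :
    ∃ G, Tendsto (greenPlusSeq hν hνk d δ z) atTop (𝓝 G) ∧ Real.log ‖z‖ - greenError δ ≤ G := by
  have h_mem (n : ℕ) : (shiftLikeStep hν hνk d δ)^[n] z ∈ filtPlus k ν R :=
    Set.MapsTo.iterate (fun _ => shiftLikeStep_mem_filtPlus hν hνk hd hδ hR) n hz
  have hd2 : (2 : ℝ) ≤ d := by exact_mod_cast hd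
  obtain ⟨G, hG, hG0⟩ := exists_tendsto_div_pow_of_abs_sub_mul_le
    (a := fun n => Real.posLog ‖(shiftLikeStep hν hνk d δ)^[n] z‖) (by linarith : (1 : ℝ) < d)
    fun n => by
      simpa only [Function.iterate_succ_apply'] using
        abs_posLog_shiftLikeStep_sub_le hν hνk hd hδ hR (h_mem n)
  refine ⟨G, by simpa only [← greenPlusSeq_eq_posLog_div_pow] using hG, ?_⟩
  have h_error : greenError δ / (d - 1) ≤ greenError δ :=
    div_le_self (add_nonneg (Real.log_nonneg one_le_two) (abs_nonneg _)) (by linarith)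
  rw [Function.iterate_zero, id, posLog_norm_eq_log_norm hR hz] at hG0
  linarith [le_abs_self (Real.log ‖z‖ - G)]

theorem tendsto_greenPlusSeq_zero_of_forall_notMem (hd : 2 ≤ d) {z : Fin k → ℂ}
    (hz : ∀ n, (shiftLikeStep hν hνk d δ)^[n] z ∉ filtPlus k ν R) :
    Tendsto (greenPlusSeq hν hνk d δ z) atTop (𝓝 0) := by
  have h_bdd (n : ℕ) : ‖(shiftLikeStep hν hνk d δ)^[n] z‖ ≤ max ‖z‖ R := by
    induction n with
    | zero => exact le_max_left _ _
    | succ n ih =>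
      have h := hz (n + 1)
      rw [Function.iterate_succ_apply'] at h ⊢
      exact (norm_shiftLikeStep_le_of_notMem_filtPlus hν hνk d δ h).trans
        (max_le ih (le_max_right _ _))
  have hd1 : (1 : ℝ) < d := by exact_mod_cast hd
  have h_lim : Tendsto (fun n : ℕ => Real.posLog (max ‖z‖ R) / (d : ℝ) ^ n) atTop (𝓝 0) :=
    (tendsto_pow_atTop_atTop_of_one_lt hd1).const_div_atTop _
  refine squeeze_zero (fun n => ?_) (fun n => ?_) h_lim
  · exact mul_nonneg (by positivity) Real.posLog_nonneg
  · rw [greenPlusSeq_eq_posLog_div_pow]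
    gcongr
    exact h_bdd n

theorem tendsto_greenPlusSeq (hd : 2 ≤ d) (hδ : δ ≠ 0) (z : Fin k → ℂ) :
    Tendsto (greenPlusSeq hν hνk d δ z) atTop (𝓝 (greenPlus hν hνk d δ z)) := by
  refine tendsto_nhds_limUnder ?_
  by_cases h_escape : ∃ m, (shiftLikeStep hν hνk d δ)^[m] z ∈ filtPlus k ν (escapeRadius δ)
  · obtain ⟨m, hm⟩ := h_escape
    obtain ⟨G, hG, -⟩ := exists_tendsto_greenPlusSeq_of_mem_filtPlus hν hνk hd hδ le_rfl hm
    refine ⟨G / (d : ℝ) ^ m, (tendsto_add_atTop_iff_nat m).mp ?_⟩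
    simp only [greenPlusSeq_add]
    exact hG.div_const _
  · push Not at h_escape
    exact ⟨0, tendsto_greenPlusSeq_zero_of_forall_notMem hν hνk hd h_escape⟩

theorem log_norm_sub_greenError_le_greenPlus (hd : 2 ≤ d) (hδ : δ ≠ 0) (hR : escapeRadius δ ≤ R)
    {z : Fin k → ℂ} (hz : z ∈ filtPlus k ν R) :
    Real.log ‖z‖ - greenError δ ≤ greenPlus hν hνk d δ z := by
  obtain ⟨G, hG, hGz⟩ := exists_tendsto_greenPlusSeq_of_mem_filtPlus hν hνk hd hδ hR hz
  rwa [tendsto_nhds_unique (tendsto_greenPlusSeq hν hνk hd hδ z) hG]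

theorem exists_forall_le_greenPlus (hd : 2 ≤ d) (hδ : δ ≠ 0) (c : ℝ) :
    ∃ R₀ : ℝ, 0 < R₀ ∧ ∀ R : ℝ, R₀ ≤ R → ∀ z ∈ filtPlus k ν R, c ≤ greenPlus hν hνk d δ z := by
  refine ⟨max (escapeRadius δ) (Real.exp (c + greenError δ)),
    lt_max_of_lt_right (Real.exp_pos _), fun R hR z hz => ?_⟩
  obtain ⟨h_escape, h_exp⟩ := max_le_iff.mp hR
  have h_exp_z := h_exp.trans (le_norm_of_mem_filtPlus hz)
  have h_log : c + greenError δ ≤ Real.log ‖z‖ :=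
    (Real.le_log_iff_exp_le ((Real.exp_pos _).trans_le h_exp_z)).mpr h_exp_z
  linarith [log_norm_sub_greenError_le_greenPlus hν hνk hd hδ h_escape hz]

end Dynamics

theorem lt_natCast_sub_one_of_add_two_eq {D : WithBot ℕ∞} {k : ℕ} (h : D + 2 = k) :
    D < (k - 1 : ℕ) := by
  by_contra! hD
  have : ((k - 1 : ℕ) : WithBot ℕ∞) + 2 ≤ k := h ▸ add_le_add_left hD 2
  have : k - 1 + 2 ≤ k := by exact_mod_cast this
  omega
theorem theorem4p4_general {k ν : ℕ} (hν : 0 < ν) (hνk : ν < k) {d : ℕ} (hd : 2 ≤ d) {δ : ℂ}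
    (hδ : δ ≠ 0) (c : ℝ) :
    (∀ z : Fin k → ℂ,
      Tendsto (greenPlusSeq hν hνk d δ z) atTop (𝓝 (greenPlus hν hνk d δ z))) ∧
    (∃ R₀ : ℝ, 0 < R₀ ∧ ∀ R : ℝ, R₀ ≤ R →
      (∀ z ∈ filtPlus k ν R, c ≤ greenPlus hν hνk d δ z) ∧
      {z : Fin k → ℂ | greenPlus hν hνk d δ z < c} ⊆ polydisc k R ∪ filtMinus k ν R) ∧
    ∀ V : Set (Fin k → ℂ), varietyDim V < ν →
      ∃ A : (Fin k → ℂ) ≃ᵃ[ℂ] (Fin k → ℂ),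
        Disjoint {z : Fin k → ℂ | greenPlus hν hνk d δ z < c} (A '' V) := by
  have : NeZero k := ⟨by omega⟩
  obtain ⟨R₀, hR₀, h_le⟩ := exists_forall_le_greenPlus hν hνk hd hδ c
  refine ⟨tendsto_greenPlusSeq hν hνk hd hδ,
    ⟨R₀, hR₀, fun R hR => ⟨h_le R hR, fun z hz => ?_⟩⟩, fun V hV => ?_⟩
  · exact mem_polydisc_union_filtMinus_of_notMem_filtPlus fun hmem => (h_le R hR z hmem).not_gt hz
  · obtain ⟨A, hA⟩ := exists_affineEquiv_image_subset_filtPlus hν hνk.le hV R₀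
    exact ⟨A, Set.disjoint_left.mpr fun z hz hzA => (h_le R₀ le_rfl z (hA hzA)).not_gt hz⟩

theorem theorem4p4 (d : ℕ) (hd : 2 ≤ d) (δ : ℂ) (hδ : δ ≠ 0) (c : ℝ) (hc : 0 < c) :
    (∀ (k ν : ℕ) (hν : 0 < ν) (hνk : ν < k),
      (∀ z : Fin k → ℂ,
        Tendsto (greenPlusSeq hν hνk d δ z) atTop (𝓝 (greenPlus hν hνk d δ z))) ∧
      ∃ R₀ : ℝ, 0 < R₀ ∧ ∀ R : ℝ, R₀ ≤ R →
        (∀ z ∈ filtPlus k ν R, c ≤ greenPlus hν hνk d δ z) ∧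
        {z : Fin k → ℂ | greenPlus hν hνk d δ z < c} ⊆ polydisc k R ∪ filtMinus k ν R) ∧
    (∀ (k : ℕ) (hk : 3 ≤ k) (V : Set (Fin k → ℂ)),
      IsAlgebraicVariety V → varietyDim V + 2 = (k : WithBot ℕ∞) →
      ∃ A : (Fin k → ℂ) ≃ᵃ[ℂ] (Fin k → ℂ),
        Disjoint
          {z : Fin k → ℂ |
            greenPlus (k := k) (ν := k - 1) (by omega) (by omega) d δ z < c}
          (A '' V)) := by
  refine ⟨fun k ν hν hνk => ?_, fun k hk V _ hV => ?_⟩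
  · obtain ⟨h_tendsto, h_filt, -⟩ := theorem4p4_general hν hνk hd hδ c
    exact ⟨h_tendsto, h_filt⟩
  · exact (theorem4p4_general _ _ hd hδ c).2.2 V (lt_natCast_sub_one_of_add_two_eq hV)
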